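/- Let $\mathcal A$ be a unital $C^*$-algebra and let $\omega_0,\omega_1$ be pure states of $\mathcal A$. A representation of $\mathcal A$ is a unital $*$-homomorphism $\pi:\mathcal A\to B(\mathfrak h)$, $\mathfrak h$ a Hilbert space; for $x\in\mathfrak h$ put $\omega_x(T)=(Tx,x)$. Two states are called disjoint if no non-zero subrepresentation of the GNS representation of the first is unitarily equivalent to a subrepresentation of the GNS representation of the second. A reduced atomic representation of $\mathcal A$ is a direct sum $(\pi,\mathfrak h)=\bigoplus_{a}(\pi_a,\mathfrak h_a)$ over a maximal family of pairwise (unitarily) inequivalent irreducible representations; it is faithful and unique up to unitary equivalence. A linear functional on the double commutant $\pi(\mathcal A)''$ is called normal if it is $\sigma$-weakly continuous. Let $(\pi,\mathfrak h)$ be a reduced atomic representation of $\mathcal A$. Then, for $i=0,1$, the functional $\omega_i\circ\pi^{-1}$ on $\pi(\mathcal A)$ has a unique normal extension $\widetilde\omega_i$ to $\pi(\mathcal A)''$, and the following are equivalent: 1. $\omega_0$ and $\omega_1$ are orthogonal, i.e. $\|\omega_0-\omega_1\|=\|\omega_0\|+\|\omega_1\|$ $(=2)$; 2. either $\omega_0$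 and $\omega_1$ are disjoint, or there exist an irreducible representation $(\pi_0,\mathfrak h_0)$ of $\mathcal A$ and orthonormal vectors $x_0,x_1\in\mathfrak h_0$ such that $\omega_0=\omega_{x_0}\circ\pi_0$ and $\omega_1=\omega_{x_1}\circ\pi_0$; 3. there exist orthonormal vectors $x_0,x_1\in\mathfrak h$ such that $\omega_0=\omega_{x_0}\circ\pi$ and $\omega_1=\omega_{x_1}\circ\pi$; 4. there exists an orthogonal projection $E\in\pi(\mathcal A)''$ such that, for all $A\in\mathcal A$, $$\widetilde\omega_0(E\pi(A)E)=\omega_0(A),\quad \widetilde\omega_0((\mathbb I-E)\pi(A)(\mathbb I-E))=0,$$ $$\widetilde\omega_1(E\pi(A)E)=0,\quad \widetilde\omega_1((\mathbb I-E)\pi(A)(\mathbb I-E))=\omega_1(A).$$ -/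

import Mathlib

open scoped ComplexOrder InnerProductSpace Topology

universe u

section PureStates

/-- The state space of a unital C*-algebra: the positive linear functionals of value `1` at the
unit (equivalently, the positive functionals of norm one), viewed in the Banach dual of `A`. -/
def stateSpace (A : Type u) [CStarAlgebra A] [PartialOrder A] : Set (StrongDual ℂ A) :=
  {ω | (∀ a : A, 0 ≤ a → 0 ≤ ω a) ∧ ω 1 = 1}

/-- The pure states: the extreme points of the (convex) state space. -/
def pureStates (A : Type u) [CStarAlgebra A] [PartialOrder A] : Set (StrongDual ℂ A) :=
  (stateSpace A).extremePoints ℝ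

/-- Two states are orthogonal if `‖ω₀ - ω₁‖ = ‖ω₀‖ + ‖ω₁‖` (which is `2`). -/
def StatesOrthogonal {A : Type u} [CStarAlgebra A] (ω₀ ω₁ : StrongDual ℂ A) : Prop :=
  ‖ω₀ - ω₁‖ = ‖ω₀‖ + ‖ω₁‖

end PureStates

/-- A representation of a unital C*-algebra: a (unital) `*`-homomorphism into the bounded operators
on a complex Hilbert space. -/
structure HilbertRep (A : Type u) [CStarAlgebra A] where
  space : Type u
  [normedAddCommGroup : NormedAddCommGroup space]
  [innerProductSpace : InnerProductSpace ℂ space]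
  [completeSpace : CompleteSpace space]
  hom : A →⋆ₐ[ℂ] (space →L[ℂ] space)

attribute [instance] HilbertRep.normedAddCommGroup HilbertRep.innerProductSpace
  HilbertRep.completeSpace

namespace HilbertRep

variable {A : Type u} [CStarAlgebra A]

/-- A subspace invariant under all the operators `π a`. -/
def IsInvariant (π : HilbertRep A) (K : Submodule ℂ π.space) : Prop :=
  ∀ a : A, ∀ x ∈ K, π.hom a x ∈ K

/-- Irreducibility: the space is non-zero and the only closed invariant subspaces are the trivial
ones. -/
structure IsIrreducible (π : HilbertRep A) : Prop where
  nontrivial : Nontrivial π.space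
  eq_bot_or_eq_top : ∀ K : Submodule ℂ π.space, IsClosed (K : Set π.space) →
    π.IsInvariant K → K = ⊥ ∨ K = ⊤

/-- Unitary equivalence of representations. -/
def UnitarilyEquivalent (π ρ : HilbertRep A) : Prop :=
  ∃ U : π.space ≃ₗᵢ[ℂ] ρ.space, ∀ (a : A) (x : π.space), U (π.hom a x) = ρ.hom a (U x)

/-- Disjointness of representations: no non-zero subrepresentation of `π` is unitarily equivalent
to a subrepresentation of `ρ`. -/
def IsDisjoint (π ρ : HilbertRep A) : Prop :=
  ∀ (K : Submodule ℂ π.space) (L : Submodule ℂ ρ.space),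
    IsClosed (K : Set π.space) → IsClosed (L : Set ρ.space) →
    ∀ (hK : π.IsInvariant K) (hL : ρ.IsInvariant L),
    (∃ U : K ≃ₗᵢ[ℂ] L, ∀ (a : A) (x : K),
      U ⟨π.hom a x, hK a x x.2⟩ = ⟨ρ.hom a (U x), hL a (U x) (U x).2⟩) → K = ⊥

/-- The functional `ω` is `ω_x ∘ π`, where `ω_x T = (T x, x)`. (Mathlib's inner product is linear in
the second variable.) -/
def IsVectorFunctional (π : HilbertRep A) (x : π.space) (ω : StrongDual ℂ A) : Prop :=
  ∀ a : A, ω a = ⟪x, π.hom a x⟫_ℂ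

/-- The functionals `ω₀` and `ω₁` are given by orthonormal vectors in the representation `π`. -/
def GivenByOrthonormalVectors (π : HilbertRep A) (ω₀ ω₁ : StrongDual ℂ A) : Prop :=
  ∃ x₀ x₁ : π.space, ‖x₀‖ = 1 ∧ ‖x₁‖ = 1 ∧ ⟪x₀, x₁⟫_ℂ = 0 ∧
    π.IsVectorFunctional x₀ ω₀ ∧ π.IsVectorFunctional x₁ ω₁

/-- The GNS representation of a positive functional. -/
noncomputable def gns [PartialOrder A] [StarOrderedRing A] (ω : StrongDual ℂ A)
    (hω : ∀ a : A, 0 ≤ a → 0 ≤ ω a) : HilbertRep A where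
  space := (PositiveLinearMap.mk₀ (ω : A →ₗ[ℂ] ℂ) hω).GNS
  hom := (PositiveLinearMap.mk₀ (ω : A →ₗ[ℂ] ℂ) hω).gnsStarAlgHom

/-- The Hilbert-space direct sum of a family of representations. -/
noncomputable def directSum {ι : Type u} (π : ι → HilbertRep A) : HilbertRep A where
  space := lp (fun i => (π i).space) 2
  hom :=
    { toFun := fun a => lp.mapCLM 2 (fun i => (π i).hom a) (norm_nonneg a)
        (fun i => NonUnitalStarAlgHom.norm_apply_le (π i).hom a)
      map_one' := by ext x i; simp
      map_mul' := fun a b => by ext x i; simp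
      map_zero' := by ext x i; simp
      map_add' := fun a b => by ext x i; simp
      commutes' := fun r => by ext x i; simp [Algebra.algebraMap_eq_smul_one]
      map_star' := fun a => by
        rw [ContinuousLinearMap.star_eq_adjoint, ContinuousLinearMap.eq_adjoint_iff]
        intro x y
        simp only [lp.inner_eq_tsum]
        refine tsum_congr fun i => ?_
        simp [map_star, ContinuousLinearMap.star_eq_adjoint,
          ContinuousLinearMap.adjoint_inner_left] }

/-- The family `π` is a maximal family of pairwise inequivalent irreducible representations:
every irreducible representation is equivalent to a member of it. (Every irreducible representation
is cyclic, hence equivalent to one whose space lies in the universe of `A`.) -/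
structure IsMaximalInequivalentFamily {ι : Type u} (π : ι → HilbertRep A) : Prop where
  irreducible : ∀ i, (π i).IsIrreducible
  inequivalent : ∀ i j, i ≠ j → ¬ (π i).UnitarilyEquivalent (π j)
  maximal : ∀ ρ : HilbertRep A, ρ.IsIrreducible → ∃ i, (π i).UnitarilyEquivalent ρ

/-- `π` is a reduced atomic representation: the direct sum of a maximal family of pairwise
inequivalent irreducible representations. -/
def IsReducedAtomic (π : HilbertRep A) : Prop :=
  ∃ (ι : Type u) (σ : ι → HilbertRep A), IsMaximalInequivalentFamily σ ∧ π = directSum σ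

theorem UnitarilyEquivalent.refl (π : HilbertRep A) : π.UnitarilyEquivalent π :=
  ⟨LinearIsometryEquiv.refl ℂ _, fun _ _ => rfl⟩

theorem UnitarilyEquivalent.symm {π ρ : HilbertRep A} (h : π.UnitarilyEquivalent ρ) :
    ρ.UnitarilyEquivalent π := by
  obtain ⟨U, hU⟩ := h
  exact ⟨U.symm, fun a x => by rw [LinearIsometryEquiv.symm_apply_eq]; simp [hU]⟩

theorem UnitarilyEquivalent.trans {π ρ τ : HilbertRep A} (h : π.UnitarilyEquivalent ρ)
    (h' : ρ.UnitarilyEquivalent τ) : π.UnitarilyEquivalent τ := by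
  obtain ⟨U, hU⟩ := h
  obtain ⟨V, hV⟩ := h'
  exact ⟨U.trans V, fun a x => by simp [hU, hV]⟩

/-- The orbit map `a ↦ π a x` of a vector. -/
noncomputable def orbitMap (π : HilbertRep A) (x : π.space) : A →ₗ[ℂ] π.space where
  toFun a := π.hom a x
  map_add' a b := by simp
  map_smul' c a := by simp

theorem IsIrreducible.denseRange_orbitMap {π : HilbertRep A} (hπ : π.IsIrreducible)
    {x : π.space} (hx : x ≠ 0) : DenseRange (π.orbitMap x) := by
  have hinv : π.IsInvariant (LinearMap.range (π.orbitMap x)).topologicalClosure := by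
    intro a y hy
    refine map_mem_closure (π.hom a).continuous hy ?_
    rintro _ ⟨b, rfl⟩
    exact ⟨a * b, by simp [orbitMap]⟩
  have hmem : x ∈ (LinearMap.range (π.orbitMap x)).topologicalClosure :=
    Submodule.le_topologicalClosure _ ⟨1, by simp [orbitMap]⟩
  rcases hπ.eq_bot_or_eq_top _ (Submodule.isClosed_topologicalClosure _) hinv with h | h
  · rw [h, Submodule.mem_bot] at hmem
    exact absurd hmem hx
  · exact Submodule.dense_iff_topologicalClosure_eq_top.mpr h

theorem norm_orbitMap_sq (π : HilbertRep A) (x : π.space) (a : A) :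
    ((‖π.orbitMap x a‖ : ℂ)) ^ 2 = ⟪x, π.hom (star a * a) x⟫_ℂ := by
  rw [map_mul, map_star, ContinuousLinearMap.star_eq_adjoint, mul_apply_eq_comp,
    ContinuousLinearMap.adjoint_inner_right, inner_self_eq_norm_sq_to_K]
  rfl

/-- Irreducible representations with a common vector functional are equivalent. -/
theorem IsIrreducible.unitarilyEquivalent {π ρ : HilbertRep A} (hπ : π.IsIrreducible)
    (hρ : ρ.IsIrreducible) {x : π.space} {y : ρ.space} (hx : x ≠ 0) (hy : y ≠ 0)
    (h : ∀ a, ⟪x, π.hom a x⟫_ℂ = ⟪y, ρ.hom a y⟫_ℂ) : π.UnitarilyEquivalent ρ := by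
  have hn : ∀ a, ‖ρ.orbitMap y (LinearEquiv.refl ℂ A a)‖ = ‖π.orbitMap x a‖ := by
    intro a
    have h2 : ((‖ρ.orbitMap y a‖ : ℂ)) ^ 2 = ((‖π.orbitMap x a‖ : ℂ)) ^ 2 := by
      rw [norm_orbitMap_sq, norm_orbitMap_sq, h]
    exact (sq_eq_sq₀ (norm_nonneg _) (norm_nonneg _)).mp (by exact_mod_cast h2)
  have dx := hπ.denseRange_orbitMap hx
  have dy := hρ.denseRange_orbitMap hy
  refine ⟨(LinearEquiv.refl ℂ A).extendOfIsometry (π.orbitMap x) (ρ.orbitMap y) dx dy hn, ?_⟩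
  intro a z
  induction z using dx.induction_on with
  | hp => exact isClosed_eq (by fun_prop) (by fun_prop)
  | ih b =>
    have e : π.hom a (π.orbitMap x b) = π.orbitMap x (a * b) := by simp [orbitMap]
    rw [e, LinearEquiv.extendOfIsometry_eq, LinearEquiv.extendOfIsometry_eq]
    simp [orbitMap]

/-- Every C*-algebra has a reduced atomic representation. -/
theorem exists_isReducedAtomic (A : Type u) [CStarAlgebra A] :
    ∃ π : HilbertRep A, π.IsReducedAtomic := by
  let s : Setoid {π : HilbertRep A // π.IsIrreducible} :=
    { r := fun π ρ => π.1.UnitarilyEquivalent ρ.1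
      iseqv := ⟨fun _ => .refl _, .symm, .trans⟩ }
  have hv : ∀ q : Quotient s, ∃ x : q.out.1.space, x ≠ 0 := fun q =>
    haveI := q.out.2.nontrivial
    exists_ne 0
  choose v hv using hv
  let f : Quotient s → (A → ℂ) := fun q a => ⟪v q, q.out.1.hom a (v q)⟫_ℂ
  have hf : Function.Injective f := by
    intro p q hpq
    have : s.r p.out q.out :=
      p.out.2.unitarilyEquivalent q.out.2 (hv p) (hv q) fun a => congrFun hpq a
    rw [← p.out_eq, ← q.out_eq]
    exact Quotient.sound this
  let e := Equiv.ofInjective f hf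
  refine ⟨_, Set.range f, fun i => (e.symm i).out.1, ⟨fun i => (e.symm i).out.2, ?_, ?_⟩, rfl⟩
  · intro i j hij hU
    refine hij (e.symm.injective ?_)
    rw [← (e.symm i).out_eq, ← (e.symm j).out_eq]
    exact Quotient.sound hU
  · intro ρ hρ
    refine ⟨e (Quotient.mk s ⟨ρ, hρ⟩), ?_⟩
    rw [Equiv.symm_apply_apply]
    exact Quotient.mk_out (s := s) ⟨ρ, hρ⟩

/-- The double commutant `π(A)''`, a `*`-algebra of operators. -/
noncomputable def bicommutant (π : HilbertRep A) :
    StarSubalgebra ℂ (π.space →L[ℂ] π.space) :=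
  StarSubalgebra.centralizer ℂ
    (StarSubalgebra.centralizer ℂ (Set.range π.hom) : Set (π.space →L[ℂ] π.space))

theorem mem_bicommutant_iff (π : HilbertRep A) (T : π.space →L[ℂ] π.space) :
    T ∈ π.bicommutant ↔
      ∀ S : π.space →L[ℂ] π.space, (∀ a, S * π.hom a = π.hom a * S) → S * T = T * S := by
  have hstar : Set.range π.hom ∪ star (Set.range π.hom) = Set.range π.hom := by
    refine Set.union_eq_left.mpr ?_
    rintro S ⟨a, ha⟩
    exact ⟨star a, by rw [map_star, ha, star_star]⟩
  rw [← SetLike.mem_coe, bicommutant, StarSubalgebra.coe_centralizer_centralizer, hstar]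
  simp only [Set.mem_centralizer_iff, Set.forall_mem_range]
  exact forall_congr' fun S => imp_congr_left (forall_congr' fun a => eq_comm)

/-- The representation, as a map into its double commutant. -/
noncomputable def toBicommutant (π : HilbertRep A) (a : A) : π.bicommutant :=
  ⟨π.hom a, (π.mem_bicommutant_iff _).mpr fun _ hS => hS a⟩

end HilbertRep

section Normal

/-- The `σ`-weak (ultraweak) topology on the bounded operators of a Hilbert space: the coarsest
topology for which all `T ↦ ∑ₙ (T yₙ, xₙ)`, with `(xₙ)` and `(yₙ)` square-summable sequences of
vectors, are continuous. -/
@[reducible]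
noncomputable def sigmaWeakTopology (H : Type u) [NormedAddCommGroup H] [InnerProductSpace ℂ H] :
    TopologicalSpace (H →L[ℂ] H) :=
  ⨅ (x : lp (fun _ : ℕ => H) 2) (y : lp (fun _ : ℕ => H) 2),
    TopologicalSpace.induced (fun T : H →L[ℂ] H => ∑' n, ⟪x n, T (y n)⟫_ℂ) inferInstance

/-- A linear functional on an algebra of operators is normal if it is `σ`-weakly continuous. -/
def IsNormalFunctional {H : Type u} [NormedAddCommGroup H] [InnerProductSpace ℂ H]
    [CompleteSpace H] {M : StarSubalgebra ℂ (H →L[ℂ] H)} (φ : M →ₗ[ℂ] ℂ) : Prop :=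
  Continuous[TopologicalSpace.induced (Subtype.val : M → (H →L[ℂ] H)) (sigmaWeakTopology H),
    inferInstance] φ

/-- `φ` is a normal functional on `π(A)''` that extends `ω ∘ π⁻¹`. -/
def IsNormalExtension {A : Type u} [CStarAlgebra A] (π : HilbertRep A) (ω : StrongDual ℂ A)
    (φ : π.bicommutant →ₗ[ℂ] ℂ) : Prop :=
  IsNormalFunctional φ ∧ ∀ a : A, φ (π.toBicommutant a) = ω a

end Normal

namespace HilbertRep

variable {A : Type u} [CStarAlgebra A]

/-! A pure state `ω` is a vector state of `π`: its GNS representation is irreducible, hence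
equivalent to exactly one summand. A vector inducing a multiple of `ω` is a multiple of this one
(`IsMaximalInequivalentFamily.exists_vector`). Indeed, each coordinate induces a functional
dominated by a multiple of `ω`, so by purity proportional to it; a non-zero coordinate in another
summand would make two summands equivalent, and inside one summand polarization gives
proportionality. An operator `S` commuting with `π` sends `x` to a vector whose functional is
dominated by `‖S‖² ω`, so `x` is an eigenvector of the whole commutant, and the projection onto `ℂ
x` lies in `π(A)''`.

The normal extension is `T ↦ ⟪x, T x⟫`. It is unique because `π(A)` is σ-weakly dense in `π(A)''`,
by the double commutant argument in a countable multiple of `π`.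

2 ⇔ 3: inducing vectors lie in the same summand or in two inequivalent ones. 3 ⇒ 4: take for `E` the
projection onto `ℂ x₀`. 4 ⇒ 1: `2E - 1` fixes `x₀` and negates `x₁`; a Kaplansky-type approximation
gives `k` in the unit ball of `A` with `ω₀ k` near `1` and `ω₁ k` near `-1`. 1 ⇒ 3: `‖ω₀ - ω₁‖ ≤ ‖x₀
+ x₁‖ ‖x₀ - x₁‖ = 2 √(1 - r²)` with `r = Re ⟪x₀, x₁⟫`, also after `x₁` is multiplied by `i`. -/

@[simp]
theorem orbitMap_apply (π : HilbertRep A) (x : π.space) (a : A) :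
    π.orbitMap x a = π.hom a x := rfl

theorem inner_hom_star_right (π : HilbertRep A) (a : A) (x y : π.space) :
    ⟪x, π.hom (star a) y⟫_ℂ = ⟪π.hom a x, y⟫_ℂ := by
  rw [map_star, ContinuousLinearMap.star_eq_adjoint, ContinuousLinearMap.adjoint_inner_right]

/-! ### Strong density of a representation in its double commutant -/

/-- The projection onto a closed invariant subspace commutes with the representation. -/
theorem IsInvariant.starProjection_comm {π : HilbertRep A} {K : Submodule ℂ π.space}
    [K.HasOrthogonalProjection] (hK : π.IsInvariant K) (a : A) (x : π.space) :
    K.starProjection (π.hom a x) = π.hom a (K.starProjection x) := by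
  refine Submodule.eq_starProjection_of_mem_of_inner_eq_zero
    (hK a _ (Submodule.starProjection_apply_mem _ _)) fun w hw => ?_
  rw [← map_sub, ← inner_hom_star_right]
  exact (K.mem_orthogonal' _).mp (K.sub_starProjection_mem_orthogonal x) _ (hK _ _ hw)

/-- The projection onto the closed cyclic subspace of `v` commutes with `π`, hence with `T`, so `T`
preserves that subspace, which contains `v`. -/
theorem mem_closure_range_orbitMap (π : HilbertRep A) {T : π.space →L[ℂ] π.space}
    (hT : T ∈ π.bicommutant) (v : π.space) : T v ∈ closure (Set.range (π.orbitMap v)) := by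
  set K := (LinearMap.range (π.orbitMap v)).topologicalClosure with hKdef
  have hinv : π.IsInvariant K := by
    intro a y hy
    refine map_mem_closure (π.hom a).continuous hy ?_
    rintro _ ⟨b, rfl⟩
    exact ⟨a * b, by simp⟩
  have hmem : v ∈ K := Submodule.le_topologicalClosure _ ⟨1, by simp⟩
  have : CompleteSpace K := (Submodule.isClosed_topologicalClosure _).completeSpace_coe
  have hcomm := (π.mem_bicommutant_iff T).mp hT K.starProjection fun a => by
    ext x
    exact hinv.starProjection_comm a x
  have h1 : K.starProjection (T v) = T (K.starProjection v) := DFunLike.congr_fun hcomm v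
  rw [Submodule.starProjection_eq_self_iff.mpr hmem] at h1
  have h2 : T v ∈ K := Submodule.starProjection_eq_self_iff.mp h1
  rw [hKdef, ← SetLike.mem_coe, Submodule.topologicalClosure_coe] at h2
  exact h2

/-- The projection of a direct sum onto a summand. -/
noncomputable def coord {ι : Type u} (σ : ι → HilbertRep A) (i : ι) :
    (directSum σ).space →L[ℂ] (σ i).space :=
  lp.evalCLM ℂ (fun i => (σ i).space) 2 i

open scoped Classical in
/-- The inclusion of a summand into a direct sum. -/
noncomputable def incl {ι : Type u} (σ : ι → HilbertRep A) (i : ι) :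
    (σ i).space →L[ℂ] (directSum σ).space :=
  lp.singleContinuousLinearMap ℂ (fun i => (σ i).space) 2 i

section DirectSum

variable {ι : Type u} (σ : ι → HilbertRep A)

theorem directSum_ext {x y : (directSum σ).space} (h : ∀ i, coord σ i x = coord σ i y) :
    x = y :=
  lp.ext (funext h)

theorem coord_hom (a : A) (x : (directSum σ).space) (i : ι) :
    coord σ i ((directSum σ).hom a x) = (σ i).hom a (coord σ i x) := rfl

theorem coord_incl_self (i : ι) (v : (σ i).space) : coord σ i (incl σ i v) = v := by
  classical
  exact lp.single_apply_self (E := fun i => (σ i).space) 2 i v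

theorem coord_incl_of_ne {i j : ι} (h : j ≠ i) (v : (σ i).space) :
    coord σ j (incl σ i v) = 0 := by
  classical
  exact lp.single_apply_ne (E := fun i => (σ i).space) 2 i v h

theorem hom_incl (a : A) (i : ι) (v : (σ i).space) :
    (directSum σ).hom a (incl σ i v) = incl σ i ((σ i).hom a v) := by
  refine directSum_ext σ fun j => ?_
  rw [coord_hom]
  rcases eq_or_ne j i with rfl | hj
  · rw [coord_incl_self, coord_incl_self]
  · rw [coord_incl_of_ne σ hj, coord_incl_of_ne σ hj, map_zero]

theorem inner_incl_left (i : ι) (v : (σ i).space) (x : (directSum σ).space) :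
    ⟪incl σ i v, x⟫_ℂ = ⟪v, coord σ i x⟫_ℂ := by
  classical
  exact lp.inner_single_left (𝕜 := ℂ) (G := fun i => (σ i).space) i v x

theorem norm_incl (i : ι) (v : (σ i).space) : ‖incl σ i v‖ = ‖v‖ := by
  classical
  exact lp.norm_single (E := fun i => (σ i).space) (p := 2) (by simp) i v

theorem norm_coord_le (i : ι) (x : (directSum σ).space) : ‖coord σ i x‖ ≤ ‖x‖ :=
  lp.norm_apply_le_norm (E := fun i => (σ i).space) (p := 2) (by simp) x i

theorem directSum_continuousLinearMap_ext {S T : (directSum σ).space →L[ℂ] (directSum σ).space}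
    (h : ∀ i v, S (incl σ i v) = T (incl σ i v)) : S = T := by
  classical
  exact lp.ext_continuousLinearMap (by simp) fun i => ContinuousLinearMap.ext (h i)

end DirectSum

/-- The diagonal action of an operator on a multiple of a representation. -/
noncomputable def amplify (π : HilbertRep A) (ι : Type u) (T : π.space →L[ℂ] π.space) :
    (directSum fun _ : ι => π).space →L[ℂ] (directSum fun _ : ι => π).space :=
  lp.mapCLM 2 (fun _ : ι => T) (norm_nonneg T) fun _ => le_rfl

theorem coord_amplify (π : HilbertRep A) (ι : Type u) (T : π.space →L[ℂ] π.space)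
    (x : (directSum fun _ : ι => π).space) (i : ι) :
    coord (fun _ : ι => π) i (π.amplify ι T x) = T (coord (fun _ : ι => π) i x) := rfl

theorem amplify_incl (π : HilbertRep A) (ι : Type u) (T : π.space →L[ℂ] π.space)
    (i : ι) (v : π.space) :
    π.amplify ι T (incl (fun _ : ι => π) i v) = incl (fun _ : ι => π) i (T v) := by
  refine directSum_ext _ fun j => ?_
  rw [coord_amplify]
  rcases eq_or_ne j i with rfl | hj
  · rw [coord_incl_self, coord_incl_self]
  · rw [coord_incl_of_ne _ hj, coord_incl_of_ne _ hj, map_zero]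

/-- The matrix entries of an operator commuting with the multiple of `π` commute with `π`, hence
with `T`. -/
theorem amplify_mem_bicommutant (π : HilbertRep A) {T : π.space →L[ℂ] π.space}
    (hT : T ∈ π.bicommutant) (ι : Type u) :
    π.amplify ι T ∈ (directSum fun _ : ι => π).bicommutant := by
  rw [mem_bicommutant_iff]
  intro S hS
  refine directSum_continuousLinearMap_ext _ fun i v => directSum_ext _ fun j => ?_
  let s : π.space →L[ℂ] π.space :=
    (coord (fun _ : ι => π) j) ∘L S ∘L (incl (fun _ : ι => π) i)
  have hsa : ∀ a, s * π.hom a = π.hom a * s := by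
    intro a
    ext w
    change coord (fun _ : ι => π) j (S (incl (fun _ : ι => π) i (π.hom a w))) =
      π.hom a (coord (fun _ : ι => π) j (S (incl (fun _ : ι => π) i w)))
    rw [← hom_incl (fun _ : ι => π), ← coord_hom (fun _ : ι => π)]
    exact congrArg (coord (fun _ : ι => π) j) (DFunLike.congr_fun (hS a) _)
  have h := DFunLike.congr_fun ((π.mem_bicommutant_iff T).mp hT s hsa) v
  change coord (fun _ : ι => π) j (S (π.amplify ι T (incl (fun _ : ι => π) i v))) =
    coord (fun _ : ι => π) j (π.amplify ι T (S (incl (fun _ : ι => π) i v)))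
  rw [amplify_incl, coord_amplify]
  exact h

/-- Elements of the double commutant are limits, in the strong operator topology, of operators of
the representation. -/
theorem exists_filter_tendsto (π : HilbertRep A) {T : π.space →L[ℂ] π.space}
    (hT : T ∈ π.bicommutant) :
    ∃ F : Filter A, F.NeBot ∧ ∀ v, Filter.Tendsto (fun a => π.hom a v) F (𝓝 (T v)) := by
  let Φ : A → π.space → π.space := fun a v => π.hom a v
  refine ⟨Filter.comap Φ (𝓝 fun v => T v), ?_, fun v => ?_⟩
  · rw [Filter.comap_neBot_iff]
    intro t ht
    obtain ⟨o, hot, ho, hTo⟩ := mem_nhds_iff.mp ht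
    obtain ⟨I, w, hw, hwo⟩ := isOpen_pi_iff.mp ho _ hTo
    -- A basic neighbourhood tests finitely many vectors `I`. Gathered into one vector `y` of a
    -- multiple of `π`, they are all approximated by a single `a`.
    let ρ := directSum fun _ : I => π
    let y : ρ.space := (⟨fun i => i.1, Memℓp.all _⟩ : lp (fun _ : I => π.space) 2)
    have hcl := ρ.mem_closure_range_orbitMap (π.amplify_mem_bicommutant hT I) y
    have hopen : IsOpen (⋂ i : I, (coord (fun _ : I => π) i) ⁻¹' (w i.1)) :=
      isOpen_iInter_of_finite fun i => (hw i.1 i.2).1.preimage (ContinuousLinearMap.continuous _)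
    obtain ⟨_, hz, a, rfl⟩ := mem_closure_iff.mp hcl _ hopen
      (Set.mem_iInter.mpr fun i => (hw i.1 i.2).2)
    refine ⟨a, hot (hwo fun v hv => ?_)⟩
    exact Set.mem_iInter.mp hz ⟨v, hv⟩
  · exact ((continuous_apply v).tendsto _).comp Filter.tendsto_comap

/-! ### Normal functionals and uniqueness of normal extensions -/

/-- A square-summable sequence of vectors of `π`, as a vector of a multiple of `π`. -/
def liftSeq (π : HilbertRep A) (x : lp (fun _ : ℕ => π.space) 2) :
    (directSum fun _ : ULift.{u} ℕ => π).space :=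
  (⟨fun n => x n.down, memℓp_gen
    ((Equiv.summable_iff Equiv.ulift).mpr ((lp.memℓp x).summable (by simp)))⟩ :
      lp (fun _ : ULift.{u} ℕ => π.space) 2)

/-- This turns σ-weak convergence of operators into weak convergence of their amplifications;
`ULift` only adjusts the universe of the index. -/
theorem tsum_inner_eq_inner_amplify (π : HilbertRep A) (T : π.space →L[ℂ] π.space)
    (x y : lp (fun _ : ℕ => π.space) 2) :
    ∑' n, ⟪x n, T (y n)⟫_ℂ = ⟪π.liftSeq x, π.amplify (ULift.{u} ℕ) T (π.liftSeq y)⟫_ℂ := by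
  rw [← Equiv.ulift.{u}.tsum_eq]
  exact (lp.inner_eq_tsum (𝕜 := ℂ) (G := fun _ : ULift.{u} ℕ => π.space)
    (π.liftSeq x) (π.amplify (ULift.{u} ℕ) T (π.liftSeq y))).symm

theorem nhds_sigmaWeakTopology {H : Type u} [NormedAddCommGroup H] [InnerProductSpace ℂ H]
    (T : H →L[ℂ] H) :
    @nhds _ (sigmaWeakTopology H) T = ⨅ (x : lp (fun _ : ℕ => H) 2) (y : lp (fun _ : ℕ => H) 2),
      Filter.comap (fun S : H →L[ℂ] H => ∑' n, ⟪x n, S (y n)⟫_ℂ)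
        (𝓝 (∑' n, ⟪x n, T (y n)⟫_ℂ)) := by
  rw [sigmaWeakTopology, nhds_iInf]
  refine iInf_congr fun x => ?_
  rw [nhds_iInf]
  exact iInf_congr fun y => @nhds_induced _ _ _ _ _

/-- Strong approximation of the amplified operator along a filter on `A` yields σ-weak approximation
of `T` itself, so both functionals are limits of the same values. -/
theorem eq_of_normal_of_eq_on_range (π : HilbertRep A) {φ ψ : π.bicommutant →ₗ[ℂ] ℂ}
    (hφ : IsNormalFunctional φ) (hψ : IsNormalFunctional ψ)
    (h : ∀ a, φ (π.toBicommutant a) = ψ (π.toBicommutant a)) : φ = ψ := by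
  ext ⟨T, hT⟩
  obtain ⟨F, hF, hlim⟩ :=
    (directSum fun _ : ULift.{u} ℕ => π).exists_filter_tendsto (π.amplify_mem_bicommutant hT _)
  have ht : Filter.Tendsto π.toBicommutant F (@nhds _ (TopologicalSpace.induced
      (Subtype.val : π.bicommutant → (π.space →L[ℂ] π.space)) (sigmaWeakTopology π.space))
      ⟨T, hT⟩) := by
    rw [@nhds_induced _ _ (sigmaWeakTopology π.space), nhds_sigmaWeakTopology,
      Filter.tendsto_comap_iff]
    simp only [Filter.tendsto_iInf, Filter.tendsto_comap_iff]
    intro x y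
    rw [tsum_inner_eq_inner_amplify]
    have : ((fun S : π.space →L[ℂ] π.space => ∑' n, ⟪x n, S (y n)⟫_ℂ) ∘ Subtype.val ∘
        π.toBicommutant) = fun a =>
          ⟪π.liftSeq x, π.amplify (ULift.{u} ℕ) (π.hom a) (π.liftSeq y)⟫_ℂ := by
      ext a
      exact π.tsum_inner_eq_inner_amplify _ _ _
    rw [this]
    exact tendsto_const_nhds.inner (hlim (π.liftSeq y))
  have h1 : Filter.Tendsto (fun a => φ (π.toBicommutant a)) F (𝓝 (φ ⟨T, hT⟩)) :=
    (@Continuous.tendsto _ _ (_) _ _ hφ _).comp ht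
  have h2 : Filter.Tendsto (fun a => ψ (π.toBicommutant a)) F (𝓝 (ψ ⟨T, hT⟩)) :=
    (@Continuous.tendsto _ _ (_) _ _ hψ _).comp ht
  simp only [h] at h1
  exact tendsto_nhds_unique h1 h2

/-- The vector functional `T ↦ (T x, x)` on the double commutant. -/
noncomputable def bicommutantFunctional (π : HilbertRep A) (x : π.space) :
    π.bicommutant →ₗ[ℂ] ℂ where
  toFun T := ⟪x, T.1 x⟫_ℂ
  map_add' S T := by simp
  map_smul' c T := by simp

theorem bicommutantFunctional_apply (π : HilbertRep A) (x : π.space) (T : π.bicommutant) :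
    π.bicommutantFunctional x T = ⟪x, T.1 x⟫_ℂ := rfl

theorem isNormalFunctional_bicommutantFunctional (π : HilbertRep A) (x : π.space) :
    IsNormalFunctional (π.bicommutantFunctional x) := by
  have key : ∀ T : π.bicommutant, π.bicommutantFunctional x T =
      ∑' n, ⟪(lp.single 2 0 x : lp (fun _ : ℕ => π.space) 2) n,
        T.1 ((lp.single 2 0 x : lp (fun _ : ℕ => π.space) 2) n)⟫_ℂ := by
    intro T
    rw [tsum_eq_single 0]
    · simp [bicommutantFunctional_apply]
    · intro n hn
      rw [lp.single_apply_ne _ _ _ hn, inner_zero_left]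
  unfold IsNormalFunctional
  rw [show (π.bicommutantFunctional x : π.bicommutant → ℂ) =
    (fun S : π.space →L[ℂ] π.space =>
      ∑' n, ⟪(lp.single 2 0 x : lp (fun _ : ℕ => π.space) 2) n,
        S ((lp.single 2 0 x : lp (fun _ : ℕ => π.space) 2) n)⟫_ℂ) ∘ Subtype.val from funext key]
  refine @Continuous.comp _ _ _ (_) (sigmaWeakTopology π.space) _ _ _ ?_
    (@continuous_induced_dom _ _ _ (sigmaWeakTopology π.space))
  rw [continuous_iff_le_induced]
  exact iInf₂_le (f := fun x y : lp (fun _ : ℕ => π.space) 2 => TopologicalSpace.induced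
    (fun T : π.space →L[ℂ] π.space => ∑' n, ⟪x n, T (y n)⟫_ℂ) inferInstance) _ _

theorem IsVectorFunctional.isNormalExtension {π : HilbertRep A} {x : π.space}
    {ω : StrongDual ℂ A} (h : π.IsVectorFunctional x ω) :
    IsNormalExtension π ω (π.bicommutantFunctional x) :=
  ⟨π.isNormalFunctional_bicommutantFunctional x, fun a => (h a).symm⟩

end HilbertRep

theorem IsNormalExtension.unique {A : Type u} [CStarAlgebra A] {π : HilbertRep A}
    {ω : StrongDual ℂ A} {φ ψ : π.bicommutant →ₗ[ℂ] ℂ} (hφ : IsNormalExtension π ω φ)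
    (hψ : IsNormalExtension π ω ψ) : φ = ψ :=
  π.eq_of_normal_of_eq_on_range hφ.1 hψ.1 fun a => (hφ.2 a).trans (hψ.2 a).symm

/-! ### Purity: domination and irreducibility -/

/-- A positive functional dominated by a pure state is a multiple of it. -/
theorem eq_smul_of_mem_pureStates_of_le {A : Type u} [CStarAlgebra A] [PartialOrder A]
    [StarOrderedRing A] {ω ρ : StrongDual ℂ A} (hω : ω ∈ pureStates A)
    (hρ : ∀ a, 0 ≤ a → 0 ≤ ρ a) {C : ℝ} (hC : ∀ a, 0 ≤ a → ρ a ≤ C * ω a) : ρ = ρ 1 • ω := by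
  obtain ⟨⟨hpos, hone⟩, hext⟩ := mem_extremePoints.mp hω
  obtain ⟨t, ht0, ht⟩ : ∃ t : ℝ, 0 ≤ t ∧ (t : ℂ) = ρ 1 := by
    have h1 := hρ 1 zero_le_one
    obtain ⟨t, ht0, ht⟩ := (RCLike.nonneg_iff_exists_ofReal (K := ℂ)).mp h1
    exact ⟨t, ht0, ht⟩
  have htC : t ≤ C := by
    have h1 := hC 1 zero_le_one
    rw [hone, ← ht, mul_one] at h1
    exact_mod_cast h1
  have e1 : (0 : ℝ) < t + 1 := by linarith
  have e2 : (0 : ℝ) < C + 1 - t := by linarith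
  -- Normalizations of the two summands of `(C + 2) ω = (ρ + ω) + ((C + 1) ω - ρ)`. The extra copy
  -- of `ω` on each side keeps both masses `t + 1` and `C + 1 - t` positive when `t = 0` or `t = C`.
  let ω₁ : StrongDual ℂ A := ((t + 1)⁻¹ : ℝ) • (ρ + ω)
  let ω₂ : StrongDual ℂ A := ((C + 1 - t)⁻¹ : ℝ) • ((C + 1 : ℝ) • ω - ρ)
  have h₁ : ω₁ ∈ stateSpace A := by
    refine ⟨fun a ha => ?_, ?_⟩
    · exact smul_nonneg (inv_nonneg.mpr e1.le) (add_nonneg (hρ a ha) (hpos a ha))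
    · change ((t + 1)⁻¹ : ℝ) • (ρ 1 + ω 1) = 1
      rw [hone, ← ht, Complex.real_smul]
      have : ((t : ℂ) + 1) ≠ 0 := by exact_mod_cast e1.ne'
      push_cast
      field_simp
  have h₂ : ω₂ ∈ stateSpace A := by
    refine ⟨fun a ha => ?_, ?_⟩
    · refine smul_nonneg (inv_nonneg.mpr e2.le) (sub_nonneg.mpr ((hC a ha).trans ?_))
      change (C : ℂ) * ω a ≤ (C + 1 : ℝ) • ω a
      rw [Complex.real_smul]
      push_cast
      rw [add_mul, one_mul]
      exact le_add_of_nonneg_right (hpos a ha)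
    · change ((C + 1 - t)⁻¹ : ℝ) • ((C + 1 : ℝ) • ω 1 - ρ 1) = 1
      rw [hone, ← ht, Complex.real_smul, Complex.real_smul]
      have : ((C : ℂ) + 1 - t) ≠ 0 := by exact_mod_cast e2.ne'
      push_cast
      field_simp
  have hseg : ω ∈ openSegment ℝ ω₁ ω₂ := by
    refine ⟨(t + 1) / (C + 2), (C + 1 - t) / (C + 2), div_pos e1 (by linarith), ?_, ?_, ?_⟩
    · exact div_pos e2 (by linarith)
    · have : C + 2 ≠ 0 := by linarith
      field_simp
      ring
    · have e3 : C + 2 ≠ 0 := by linarith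
      simp only [ω₁, ω₂, smul_smul]
      have a1 : (t + 1) / (C + 2) * (t + 1)⁻¹ = (C + 2)⁻¹ := by field_simp
      have a2 : (C + 1 - t) / (C + 2) * (C + 1 - t)⁻¹ = (C + 2)⁻¹ := by field_simp
      rw [a1, a2, ← smul_add (C + 2)⁻¹ (ρ + ω),
        show ρ + ω + ((C + 1 : ℝ) • ω - ρ) = (C + 2 : ℝ) • ω by module,
        smul_smul, inv_mul_cancel₀ e3, one_smul]
  have h := (hext ω₁ h₁ ω₂ h₂ hseg).1
  ext a
  have ha : ((t + 1)⁻¹ : ℝ) • (ρ a + ω a) = ω a := DFunLike.congr_fun h a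
  have : ((t : ℂ) + 1) ≠ 0 := by exact_mod_cast e1.ne'
  rw [Complex.real_smul] at ha
  push_cast at ha
  field_simp at ha
  change ρ a = ρ 1 * ω a
  rw [← ht]
  linear_combination ha

namespace HilbertRep

variable {A : Type u} [CStarAlgebra A]

theorem norm_hom_le (π : HilbertRep A) (a : A) : ‖π.hom a‖ ≤ ‖a‖ :=
  NonUnitalStarAlgHom.norm_apply_le π.hom a

theorem inner_hom_star_mul_self (π : HilbertRep A) (x : π.space) (b : A) :
    ⟪x, π.hom (star b * b) x⟫_ℂ = ((‖π.hom b x‖ ^ 2 : ℝ) : ℂ) := by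
  rw [← norm_orbitMap_sq]
  simp

theorem inner_hom_nonneg [PartialOrder A] [StarOrderedRing A] (π : HilbertRep A) (x : π.space)
    {a : A} (ha : 0 ≤ a) : 0 ≤ ⟪x, π.hom a x⟫_ℂ := by
  obtain ⟨b, rfl⟩ := CStarAlgebra.nonneg_iff_eq_star_mul_self.mp ha
  rw [inner_hom_star_mul_self]
  exact_mod_cast sq_nonneg ‖π.hom b x‖

/-- The vector functional `ω_x ∘ π`. -/
noncomputable def vectorFunctional (π : HilbertRep A) (x : π.space) : StrongDual ℂ A :=
  LinearMap.mkContinuous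
    { toFun := fun a => ⟪x, π.hom a x⟫_ℂ
      map_add' := fun a b => by simp
      map_smul' := fun c a => by simp } (‖x‖ ^ 2) fun a =>
    calc ‖⟪x, π.hom a x⟫_ℂ‖ ≤ ‖x‖ * (‖a‖ * ‖x‖) :=
          (norm_inner_le_norm _ _).trans (by
            gcongr
            exact (π.hom a).le_of_opNorm_le (π.norm_hom_le a) x)
      _ = ‖x‖ ^ 2 * ‖a‖ := by ring

theorem vectorFunctional_apply (π : HilbertRep A) (x : π.space) (a : A) :
    π.vectorFunctional x a = ⟪x, π.hom a x⟫_ℂ := rfl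

/-- A vector functional dominated by a pure state is a multiple of it. -/
theorem inner_hom_eq_of_norm_sq_le [PartialOrder A] [StarOrderedRing A] {ω : StrongDual ℂ A}
    (hω : ω ∈ pureStates A) (ρ : HilbertRep A) (y : ρ.space) (C : ℝ)
    (h : ∀ b, ((‖ρ.hom b y‖ ^ 2 : ℝ) : ℂ) ≤ C * ω (star b * b)) (a : A) :
    ⟪y, ρ.hom a y⟫_ℂ = ((‖y‖ ^ 2 : ℝ) : ℂ) * ω a := by
  have key := eq_smul_of_mem_pureStates_of_le hω (ρ := ρ.vectorFunctional y) (C := C)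
    (fun a ha => ρ.inner_hom_nonneg y ha) (fun a ha => by
      obtain ⟨b, rfl⟩ := CStarAlgebra.nonneg_iff_eq_star_mul_self.mp ha
      rw [vectorFunctional_apply, inner_hom_star_mul_self]
      exact h b)
  have h1 := DFunLike.congr_fun key a
  rw [vectorFunctional_apply] at h1
  rw [h1]
  change ⟪y, ρ.hom 1 y⟫_ℂ * ω a = _
  rw [map_one, one_apply_eq_self, inner_self_eq_norm_sq_to_K]
  simp

theorem IsVectorFunctional.norm_sq {π : HilbertRep A} {x : π.space} {ω : StrongDual ℂ A}
    (h : π.IsVectorFunctional x ω) (b : A) :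
    ((‖π.hom b x‖ ^ 2 : ℝ) : ℂ) = ω (star b * b) := by
  rw [h, inner_hom_star_mul_self]

theorem IsVectorFunctional.norm_eq_one [PartialOrder A] {π : HilbertRep A} {x : π.space}
    {ω : StrongDual ℂ A} (h : π.IsVectorFunctional x ω) (hω : ω ∈ stateSpace A) : ‖x‖ = 1 := by
  have h1 := h.norm_sq 1
  rw [map_one, star_one, one_mul, hω.2, one_apply_eq_self] at h1
  have h2 : ‖x‖ ^ 2 = 1 := by exact_mod_cast h1
  exact (pow_eq_one_iff_of_nonneg (norm_nonneg x) two_ne_zero).mp h2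

theorem eq_of_forall_inner_hom_eq {π : HilbertRep A} {x y z : π.space}
    (hx : DenseRange (π.orbitMap x)) (h : ∀ a, ⟪x, π.hom a y⟫_ℂ = ⟪x, π.hom a z⟫_ℂ) : y = z := by
  refine hx.eq_of_inner_right (𝕜 := ℂ) fun a => ?_
  have := h (star a)
  rwa [inner_hom_star_right, inner_hom_star_right] at this

/-- A cyclic representation with a cyclic vector inducing a pure state is irreducible. -/
theorem IsVectorFunctional.isIrreducible [PartialOrder A] [StarOrderedRing A] {π : HilbertRep A}
    {x : π.space} {ω : StrongDual ℂ A} (h : π.IsVectorFunctional x ω) (hω : ω ∈ pureStates A)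
    (hx : DenseRange (π.orbitMap x)) : π.IsIrreducible := by
  have hx1 : ‖x‖ = 1 := h.norm_eq_one hω.1
  have hx0 : x ≠ 0 := by
    rintro rfl
    exact zero_ne_one (norm_zero.symm.trans hx1)
  refine ⟨⟨x, 0, hx0⟩, fun K hKc hK => ?_⟩
  have : CompleteSpace K := hKc.completeSpace_coe
  -- The projection commutes with `π` and is contractive, so the projected vector induces a
  -- functional dominated by `ω`. Purity then makes `x` an eigenvector of the projection, with
  -- eigenvalue `t` equal to `0` or `1`.
  have key := inner_hom_eq_of_norm_sq_le hω π (K.starProjection x) 1 fun b => by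
    rw [← hK.starProjection_comm, Complex.ofReal_one, one_mul, ← h.norm_sq]
    exact_mod_cast pow_le_pow_left₀ (norm_nonneg _) (K.norm_starProjection_apply_le _) 2
  set t : ℂ := ((‖K.starProjection x‖ ^ 2 : ℝ) : ℂ)
  have hp : K.starProjection x = t • x := by
    refine eq_of_forall_inner_hom_eq hx fun a => ?_
    rw [map_smul, inner_smul_right, ← h a, ← key a, ← hK.starProjection_comm,
      Submodule.inner_starProjection_left_eq_right, Submodule.starProjection_eq_self_iff.mpr
        (Submodule.starProjection_apply_mem _ _)]
  have hpp : t • x = (t * t) • x := by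
    have := Submodule.starProjection_eq_self_iff.mpr (K.starProjection_apply_mem x)
    rw [hp, map_smul, hp, smul_smul] at this
    exact this.symm
  have ht : t * (1 - t) = 0 := by
    have := smul_left_injective ℂ hx0 hpp
    linear_combination this
  rcases mul_eq_zero.mp ht with h0 | h1
  · left
    rw [Submodule.eq_bot_iff]
    intro y hy
    have : K.starProjection = 0 := by
      refine ContinuousLinearMap.ext fun z => ?_
      refine congrFun (hx.equalizer K.starProjection.continuous continuous_zero ?_) z
      ext a
      simp [hK.starProjection_comm, hp, h0]
    rw [← Submodule.starProjection_eq_self_iff.mpr hy, this]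
    rfl
  · right
    have h1' : t = 1 := by linear_combination -h1
    have hxK : x ∈ K := Submodule.starProjection_eq_self_iff.mp (by rw [hp, h1', one_smul])
    rw [eq_top_iff]
    intro y _
    refine hKc.closure_subset_iff.mpr ?_ (hx y)
    rintro _ ⟨a, rfl⟩
    exact hK a x hxK

/-! ### The GNS representation and its cyclic vector -/

section GNS

variable [PartialOrder A] [StarOrderedRing A] (ω : StrongDual ℂ A)
    (hω : ∀ a : A, 0 ≤ a → 0 ≤ ω a)

/-- The canonical cyclic vector of the GNS representation. -/
noncomputable def gnsVector : (gns ω hω).space :=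
  (((PositiveLinearMap.mk₀ (ω : A →ₗ[ℂ] ℂ) hω).toPreGNS 1 :
    (PositiveLinearMap.mk₀ (ω : A →ₗ[ℂ] ℂ) hω).PreGNS) :
      (PositiveLinearMap.mk₀ (ω : A →ₗ[ℂ] ℂ) hω).GNS)

theorem gns_hom_gnsVector (a : A) : (gns ω hω).hom a (gnsVector ω hω) =
    (((PositiveLinearMap.mk₀ (ω : A →ₗ[ℂ] ℂ) hω).toPreGNS a :
      (PositiveLinearMap.mk₀ (ω : A →ₗ[ℂ] ℂ) hω).PreGNS) :
        (PositiveLinearMap.mk₀ (ω : A →ₗ[ℂ] ℂ) hω).GNS) := by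
  refine (PositiveLinearMap.gnsNonUnitalStarAlgHom_apply_coe _).trans ?_
  simp

theorem denseRange_orbitMap_gnsVector :
    DenseRange ((gns ω hω).orbitMap (gnsVector ω hω)) := by
  have : ((gns ω hω).orbitMap (gnsVector ω hω) : A → (gns ω hω).space) =
      fun a => (((PositiveLinearMap.mk₀ (ω : A →ₗ[ℂ] ℂ) hω).toPreGNS a :
      (PositiveLinearMap.mk₀ (ω : A →ₗ[ℂ] ℂ) hω).PreGNS) :
        (PositiveLinearMap.mk₀ (ω : A →ₗ[ℂ] ℂ) hω).GNS) := funext (gns_hom_gnsVector ω hω)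
  rw [this]
  exact UniformSpace.Completion.denseRange_coe (α :=
    (PositiveLinearMap.mk₀ (ω : A →ₗ[ℂ] ℂ) hω).PreGNS)

theorem isVectorFunctional_gnsVector : (gns ω hω).IsVectorFunctional (gnsVector ω hω) ω := by
  intro a
  rw [gns_hom_gnsVector]
  refine Eq.trans ?_ (UniformSpace.Completion.inner_coe (𝕜 := ℂ) _ _).symm
  rw [PositiveLinearMap.preGNS_inner_def]
  simp
  rfl

end GNS

theorem isIrreducible_gns [PartialOrder A] [StarOrderedRing A] {ω : StrongDual ℂ A}
    (hω : ω ∈ pureStates A) : (gns ω hω.1.1).IsIrreducible :=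
  (isVectorFunctional_gnsVector ω hω.1.1).isIrreducible hω (denseRange_orbitMap_gnsVector ω hω.1.1)

theorem IsVectorFunctional.ne_zero [PartialOrder A] {π : HilbertRep A} {x : π.space}
    {ω : StrongDual ℂ A} (h : π.IsVectorFunctional x ω) (hω : ω ∈ stateSpace A) : x ≠ 0 := by
  rintro rfl
  simpa using h.norm_eq_one hω

/-! ### Uniqueness of inducing vectors and rank-one projections -/

/-- In an irreducible representation, a vector inducing a pure state is determined by it up to a
scalar. -/
theorem IsIrreducible.exists_eq_smul [PartialOrder A] [StarOrderedRing A] {π : HilbertRep A}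
    (hπ : π.IsIrreducible) {ω : StrongDual ℂ A} (hω : ω ∈ pureStates A) {x y : π.space}
    (hx : π.IsVectorFunctional x ω) {μ : ℝ} (hy : ∀ a, ⟪y, π.hom a y⟫_ℂ = μ * ω a) :
    ∃ ν : ℂ, y = ν • x := by
  have hn : ∀ b, ((‖π.hom b y‖ ^ 2 : ℝ) : ℂ) = μ * ω (star b * b) := fun b => by
    rw [← hy, inner_hom_star_mul_self]
  -- By the parallelogram bound, `x + ζ y` is dominated by `2 (1 + μ) ω`, so it also induces a
  -- multiple of `ω`.
  have hζ : ∀ ζ : ℂ, ‖ζ‖ = 1 → ∃ c : ℂ, ∀ a,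
      ⟪x + ζ • y, π.hom a (x + ζ • y)⟫_ℂ = c * ω a := by
    intro ζ hζ
    refine ⟨_, inner_hom_eq_of_norm_sq_le hω π (x + ζ • y) (2 * (1 + μ)) fun b => ?_⟩
    push_cast
    rw [show (2 * (1 + μ) * ω (star b * b) : ℂ) =
      2 * (ω (star b * b) + μ * ω (star b * b)) by ring, ← hn, ← hx.norm_sq]
    have : ‖π.hom b (x + ζ • y)‖ ≤ ‖π.hom b x‖ + ‖π.hom b y‖ := by
      rw [map_add, map_smul]
      refine (norm_add_le _ _).trans ?_
      rw [norm_smul, hζ, one_mul]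
    have h2 : ‖π.hom b (x + ζ • y)‖ ^ 2 ≤ 2 * (‖π.hom b x‖ ^ 2 + ‖π.hom b y‖ ^ 2) := by
      nlinarith [norm_nonneg (π.hom b (x + ζ • y)), sq_nonneg (‖π.hom b x‖ - ‖π.hom b y‖)]
    exact_mod_cast h2
  obtain ⟨α, hα⟩ := hζ 1 (by simp)
  obtain ⟨β, hβ⟩ := hζ Complex.I (by simp)
  -- Polarization with `ζ = 1` and `ζ = i`: the combination `α - i β` isolates `2 ⟪x, π a y⟫` up to
  -- the term `(1 - i)(1 + μ) ω a`.
  refine ⟨(α - Complex.I * β - (1 - Complex.I) * (1 + μ)) / 2,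
    eq_of_forall_inner_hom_eq (hπ.denseRange_orbitMap (hx.ne_zero hω.1)) fun a => ?_⟩
  have h1 := hα a
  have h2 := hβ a
  simp only [map_add, map_smul, inner_add_left, inner_add_right, inner_smul_left,
    inner_smul_right, hy, ← hx a, map_one, Complex.conj_I, one_mul] at h1 h2
  rw [map_smul, inner_smul_right, ← hx a]
  linear_combination (1 / 2) * h1 - (Complex.I / 2) * h2 +
    (⟪x, π.hom a y⟫_ℂ - ⟪y, π.hom a x⟫_ℂ - Complex.I * μ * ω a) / 2 * Complex.I_sq

/-- A pure state is induced by a vector of one summand of a reduced atomic representation, and the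
vectors inducing multiples of the state are the multiples of this one. -/
theorem IsMaximalInequivalentFamily.exists_vector [PartialOrder A] [StarOrderedRing A] {ι : Type u}
    {σ : ι → HilbertRep A} (hσ : IsMaximalInequivalentFamily σ) {ω : StrongDual ℂ A}
    (hω : ω ∈ pureStates A) :
    ∃ (i : ι) (x : (σ i).space), (σ i).UnitarilyEquivalent (gns ω hω.1.1) ∧
      (σ i).IsVectorFunctional x ω ∧
      ∀ (y : (directSum σ).space) (μ : ℝ), (∀ a, ⟪y, (directSum σ).hom a y⟫_ℂ = μ * ω a) →
        ∃ ν : ℂ, y = ν • incl σ i x := by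
  obtain ⟨i, hi⟩ := hσ.maximal _ (isIrreducible_gns hω)
  obtain ⟨U, hU⟩ := hi
  have hx : (σ i).IsVectorFunctional (U.symm (gnsVector ω hω.1.1)) ω := by
    intro a
    rw [isVectorFunctional_gnsVector ω hω.1.1 a, ← U.inner_map_map, hU,
      LinearIsometryEquiv.apply_symm_apply]
  set x := U.symm (gnsVector ω hω.1.1)
  refine ⟨i, x, ⟨U, hU⟩, hx, fun y μ hy => ?_⟩
  have hj : ∀ j a, ⟪coord σ j y, (σ j).hom a (coord σ j y)⟫_ℂ =
      ((‖coord σ j y‖ ^ 2 : ℝ) : ℂ) * ω a := fun j =>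
    inner_hom_eq_of_norm_sq_le hω _ _ μ fun b => by
      rw [← hy, inner_hom_star_mul_self, ← coord_hom]
      exact_mod_cast pow_le_pow_left₀ (norm_nonneg _) (norm_coord_le σ j _) 2
  obtain ⟨ν, hν⟩ := (hσ.irreducible i).exists_eq_smul hω hx (hj i)
  refine ⟨ν, directSum_ext σ fun j => ?_⟩
  rw [map_smul]
  rcases eq_or_ne j i with rfl | hji
  · rw [coord_incl_self, hν]
  · rw [coord_incl_of_ne σ hji, smul_zero]
    by_contra h0
    refine hσ.inequivalent j i hji ((hσ.irreducible j).unitarilyEquivalent (hσ.irreducible i) h0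
      (y := ((‖coord σ j y‖ : ℝ) : ℂ) • x)
      (smul_ne_zero (by simpa using h0) (hx.ne_zero hω.1)) fun a => ?_)
    rw [hj, map_smul, inner_smul_left, inner_smul_right, ← hx a]
    simp
    ring

theorem IsVectorFunctional.incl {ι : Type u} {σ : ι → HilbertRep A} {i : ι} {x : (σ i).space}
    {ω : StrongDual ℂ A} (h : (σ i).IsVectorFunctional x ω) :
    (directSum σ).IsVectorFunctional (incl σ i x) ω := by
  intro a
  rw [h, inner_incl_left, coord_hom, coord_incl_self]

/-- The projection onto a vector inducing a pure state belongs to the double commutant of a reduced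
atomic representation. -/
theorem IsReducedAtomic.starProjection_mem_bicommutant [PartialOrder A] [StarOrderedRing A]
    {π : HilbertRep A} (hπ : π.IsReducedAtomic) {ω : StrongDual ℂ A} (hω : ω ∈ pureStates A)
    {x : π.space} (hx : π.IsVectorFunctional x ω) :
    (ℂ ∙ x).starProjection ∈ π.bicommutant := by
  have hx1 := hx.norm_eq_one hω.1
  obtain ⟨ι, σ, hσ, rfl⟩ := hπ
  obtain ⟨i, z, -, -, hz⟩ := hσ.exists_vector hω
  have hxz := hz x 1 fun a => by rw [← hx a]; simp
  obtain ⟨c, hc⟩ := hxz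
  have key : ∀ S : (directSum σ).space →L[ℂ] (directSum σ).space,
      (∀ a, S * (directSum σ).hom a = (directSum σ).hom a * S) → ∃ ν : ℂ, S x = ν • x := by
    intro S hS
    have hSa : ∀ a v, S ((directSum σ).hom a v) = (directSum σ).hom a (S v) := fun a v =>
      DFunLike.congr_fun (hS a) v
    obtain ⟨ν, hν⟩ := hz (S x) _ (inner_hom_eq_of_norm_sq_le hω _ _ (‖S‖ ^ 2) fun b => by
      rw [← hx.norm_sq, ← hSa]
      have := pow_le_pow_left₀ (norm_nonneg _) (S.le_opNorm ((directSum σ).hom b x)) 2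
      rw [mul_pow] at this
      exact_mod_cast this)
    have hc0 : c ≠ 0 := by
      rintro rfl
      rw [hc, zero_smul, norm_zero] at hx1
      exact zero_ne_one hx1
    exact ⟨ν / c, by rw [hν, hc, smul_smul, div_mul_cancel₀ _ hc0]⟩
  rw [mem_bicommutant_iff]
  intro S hS
  obtain ⟨ν, hν⟩ := key S hS
  -- The adjoint commutes with `π` too; `x` being an eigenvector of both, the line `ℂ x` reduces
  -- `S`.
  obtain ⟨ν', hν'⟩ := key (ContinuousLinearMap.adjoint S) fun a => by
    have := congrArg star (hS (star a))
    rw [star_mul, star_mul, map_star, star_star] at this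
    exact this.symm
  have hνν : ∀ w, ⟪x, S w⟫_ℂ = ν * ⟪x, w⟫_ℂ := by
    intro w
    have h1 : ⟪x, S x⟫_ℂ = (starRingEnd ℂ) ν' * ⟪x, x⟫_ℂ := by
      rw [← ContinuousLinearMap.adjoint_inner_left, hν', inner_smul_left]
    rw [hν, inner_smul_right, inner_self_eq_norm_sq_to_K, hx1] at h1
    rw [← ContinuousLinearMap.adjoint_inner_left, hν', inner_smul_left]
    simp only [Complex.coe_algebraMap, Complex.ofReal_one, one_pow, mul_one] at h1
    rw [h1]
  ext w
  change S ((ℂ ∙ x).starProjection w) = (ℂ ∙ x).starProjection (S w)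
  rw [Submodule.starProjection_unit_singleton ℂ hx1, Submodule.starProjection_unit_singleton ℂ hx1,
    map_smul, hν, hνν, smul_smul, mul_comm]

/-! ### Approximation by self-adjoint elements of the unit ball -/

/-- A self-adjoint element of the double commutant is approximated strongly, on two vectors, by
self-adjoint elements of the algebra. -/
theorem mem_closure_selfAdjoint (π : HilbertRep A) {T : π.space →L[ℂ] π.space}
    (hT : T ∈ π.bicommutant) (hsa : IsSelfAdjoint T) (x y : π.space) :
    (T x, T y) ∈ closure {p : π.space × π.space |
      ∃ h : A, IsSelfAdjoint h ∧ p = (π.hom h x, π.hom h y)} := by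
  set s : Set (π.space × π.space) := {p | ∃ h : A, IsSelfAdjoint h ∧ p = (π.hom h x, π.hom h y)}
  have hsmul : ∀ (r : ℝ) (h : A), π.hom (r • h) = r • π.hom h := fun r h => by
    rw [← Complex.coe_smul, map_smul, Complex.coe_smul]
  have hconv : Convex ℝ s := by
    rintro _ ⟨h, hh, rfl⟩ _ ⟨k, hk, rfl⟩ c d - - -
    refine ⟨c • h + d • k, ((IsSelfAdjoint.all c).smul hh).add ((IsSelfAdjoint.all d).smul hk), ?_⟩
    simp [hsmul]
  by_contra hnot
  obtain ⟨f, u, hfu, hub⟩ :=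
    RCLike.geometric_hahn_banach_point_closed (𝕜 := ℂ) hconv.closure isClosed_closure hnot
  let v := (InnerProductSpace.toDual ℂ π.space).symm
    (f ∘L ContinuousLinearMap.inl ℂ π.space π.space)
  let w := (InnerProductSpace.toDual ℂ π.space).symm
    (f ∘L ContinuousLinearMap.inr ℂ π.space π.space)
  have hf : ∀ p q, f (p, q) = ⟪v, p⟫_ℂ + ⟪w, q⟫_ℂ := by
    intro p q
    simp only [v, w, InnerProductSpace.toDual_symm_apply, ContinuousLinearMap.comp_apply,
      ContinuousLinearMap.inl_apply, ContinuousLinearMap.inr_apply, ← map_add]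
    simp
  have hmem : ∀ h : A, IsSelfAdjoint h → (π.hom h x, π.hom h y) ∈ closure s := fun h hh =>
    subset_closure ⟨h, hh, rfl⟩
  have hu0 : u < 0 := by
    have := hub _ (hmem 0 (IsSelfAdjoint.zero A))
    simpa [hf] using this
  -- The pairs form a real linear space, on which a real functional bounded below must vanish.
  have hzero : ∀ h : A, IsSelfAdjoint h → (f (π.hom h x, π.hom h y)).re = 0 := by
    intro h hh
    by_contra hne
    set c := (f (π.hom h x, π.hom h y)).re
    have := hub _ (hmem ((u / c) • h) ((IsSelfAdjoint.all (u / c)).smul hh))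
    rw [hsmul] at this
    have e : f (((u / c) • π.hom h) x, ((u / c) • π.hom h) y) =
        ((u / c : ℝ) : ℂ) * f (π.hom h x, π.hom h y) := by
      simp only [hf, smul_apply, ← Complex.coe_smul, inner_smul_right]
      ring
    rw [e] at this
    change u < (((u / c : ℝ) : ℂ) * f (π.hom h x, π.hom h y)).re at this
    rw [Complex.re_ofReal_mul] at this
    change u < u / c * c at this
    rw [div_mul_cancel₀ _ hne] at this
    exact lt_irrefl _ this
  -- A complex-linear, strongly continuous functional equal to `2 Re f` on self-adjoint operators.
  -- It vanishes on self-adjoint elements, hence on `π(A)`, hence at `T`, which contradicts the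
  -- separation. Symmetrizing avoids continuity of the adjoint.
  let G : (π.space →L[ℂ] π.space) → ℂ := fun S =>
    ⟪v, S x⟫_ℂ + ⟪x, S v⟫_ℂ + (⟪w, S y⟫_ℂ + ⟪y, S w⟫_ℂ)
  have hG : ∀ S : π.space →L[ℂ] π.space, IsSelfAdjoint S →
      G S = ((2 * (f (S x, S y)).re : ℝ) : ℂ) := by
    intro S hS
    have e : ∀ p q, ⟪q, S p⟫_ℂ = (starRingEnd ℂ) ⟪p, S q⟫_ℂ := fun p q => by
      rw [inner_conj_symm, ← ContinuousLinearMap.adjoint_inner_left]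
      rw [ContinuousLinearMap.isSelfAdjoint_iff'.mp hS]
    simp only [G]
    rw [e v x, e w y, Complex.add_conj, Complex.add_conj, hf, Complex.add_re]
    push_cast
    ring
  have hGsa : ∀ h : A, IsSelfAdjoint h → G (π.hom h) = 0 := by
    intro h hh
    rw [hG _ (hh.map π.hom), hzero h hh]
    simp
  have hGa : ∀ a : A, G (π.hom a) = 0 := by
    intro a
    rw [← realPart_add_I_smul_imaginaryPart a]
    have h1 := hGsa _ (realPart a).2
    have h2 := hGsa _ (imaginaryPart a).2
    simp only [G] at h1 h2 ⊢
    simp only [map_add, map_smul, add_apply, smul_apply,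
      inner_add_right, inner_smul_right]
    linear_combination h1 + Complex.I * h2
  obtain ⟨F, hF, hlim⟩ := π.exists_filter_tendsto hT
  have hGT : Filter.Tendsto (fun a => G (π.hom a)) F (𝓝 (G T)) :=
    ((tendsto_const_nhds.inner (hlim x)).add (tendsto_const_nhds.inner (hlim v))).add
      ((tendsto_const_nhds.inner (hlim y)).add (tendsto_const_nhds.inner (hlim w)))
  simp only [hGa] at hGT
  have h0 := tendsto_nhds_unique tendsto_const_nhds hGT
  rw [hG T hsa] at h0
  have h1 : (f (T x, T y)).re = 0 := by
    have : 2 * (f (T x, T y)).re = 0 := by exact_mod_cast h0.symm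
    linarith
  change (f (T x, T y)).re < u at hfu
  linarith

theorem norm_hom_apply_le_of_star_mul_self_le [PartialOrder A] [StarOrderedRing A]
    (π : HilbertRep A) {a b : A} (h : star a * a ≤ star b * b) (x : π.space) :
    ‖π.hom a x‖ ≤ ‖π.hom b x‖ := by
  have h1 := π.inner_hom_nonneg x (sub_nonneg.mpr h)
  rw [map_sub, sub_apply, inner_sub_right, sub_nonneg,
    inner_hom_star_mul_self, inner_hom_star_mul_self] at h1
  have h2 : ‖π.hom a x‖ ^ 2 ≤ ‖π.hom b x‖ ^ 2 := by exact_mod_cast h1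
  exact (sq_le_sq₀ (norm_nonneg _) (norm_nonneg _)).mp h2

end HilbertRep

/-- Truncation of a self-adjoint element to the unit ball, without increasing its distance from
`±1`. -/
theorem IsSelfAdjoint.exists_norm_le_one_star_mul_self_le {A : Type*} [CStarAlgebra A]
    [PartialOrder A] [StarOrderedRing A] {h : A} (hh : IsSelfAdjoint h) :
    ∃ k : A, ‖k‖ ≤ 1 ∧ star (k - 1) * (k - 1) ≤ star (h - 1) * (h - 1) ∧
      star (k + 1) * (k + 1) ≤ star (h + 1) * (h + 1) := by
  let f : ℝ → ℝ := fun t => max (-1) (min 1 t)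
  have hf : Continuous f := by fun_prop
  -- Clamping to `[-1, 1]` is 1-Lipschitz and fixes `s`; only `s = ±1` is needed.
  have htrunc : ∀ t s : ℝ, -1 ≤ s → s ≤ 1 → |f t - s| ≤ |t - s| := fun t s h1 h2 => by
    have hs : max (-1) (min 1 s) = s := by rw [min_eq_right h2, max_eq_right h1]
    calc |f t - s| = |max (-1) (min 1 t) - max (-1) (min 1 s)| := by rw [hs]
      _ ≤ |min 1 t - min 1 s| := by
        simpa using abs_max_sub_max_le_max (-1) (min 1 t) (-1) (min 1 s)
      _ ≤ |t - s| := by simpa using abs_min_sub_min_le_max 1 t 1 s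
  have e1 : ∀ g : ℝ → ℝ, Continuous g → star (cfc g h - 1) * (cfc g h - 1) =
      cfc (fun t => (g t - 1) * (g t - 1)) h := fun g hg => by
    have hs : IsSelfAdjoint (cfc g h) := cfc_predicate g h
    rw [(hs.sub (IsSelfAdjoint.one A)).star_eq, cfc_mul (fun t => g t - 1) (fun t => g t - 1) h,
      cfc_sub g (fun _ => 1) h, cfc_const_one ℝ h]
  have e2 : ∀ g : ℝ → ℝ, Continuous g → star (cfc g h + 1) * (cfc g h + 1) =
      cfc (fun t => (g t + 1) * (g t + 1)) h := fun g hg => by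
    have hs : IsSelfAdjoint (cfc g h) := cfc_predicate g h
    rw [(hs.add (IsSelfAdjoint.one A)).star_eq, cfc_mul (fun t => g t + 1) (fun t => g t + 1) h,
      cfc_add h g (fun _ => 1), cfc_const_one ℝ h]
  have hid : h = cfc (fun t : ℝ => t) h := (cfc_id' ℝ h).symm
  refine ⟨cfc f h, norm_cfc_le zero_le_one fun t _ => ?_, ?_, ?_⟩
  · rw [Real.norm_eq_abs, abs_le]
    exact ⟨le_max_left _ _, max_le (by norm_num) (min_le_left _ _)⟩
  · rw [e1 f hf, show star (h - 1) * (h - 1) = cfc (fun t : ℝ => (t - 1) * (t - 1)) h by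
      rw [← e1 _ continuous_id', ← hid]]
    refine cfc_mono fun t _ => ?_
    rw [← sq, ← sq, sq_le_sq]
    exact htrunc t 1 (by norm_num) le_rfl
  · rw [e2 f hf, show star (h + 1) * (h + 1) = cfc (fun t : ℝ => (t + 1) * (t + 1)) h by
      rw [← e2 _ continuous_id', ← hid]]
    refine cfc_mono fun t _ => ?_
    rw [← sq, ← sq, sq_le_sq]
    simpa using htrunc t (-1) le_rfl (by norm_num)

namespace HilbertRep

variable {A : Type u} [CStarAlgebra A]

/-! ### Orthogonality of states and of vectors -/

theorem IsVectorFunctional.norm_apply_le {π : HilbertRep A} {x : π.space} {ω : StrongDual ℂ A}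
    (h : π.IsVectorFunctional x ω) (hx : ‖x‖ = 1) (a : A) : ‖ω a‖ ≤ ‖a‖ := by
  rw [h a]
  refine (norm_inner_le_norm _ _).trans ?_
  rw [hx, one_mul]
  exact ((π.hom a).le_of_opNorm_le (π.norm_hom_le a) x).trans (by rw [hx, mul_one])

theorem IsVectorFunctional.norm_functional_eq_one [PartialOrder A] {π : HilbertRep A}
    {x : π.space} {ω : StrongDual ℂ A} (h : π.IsVectorFunctional x ω) (hω : ω ∈ stateSpace A) :
    ‖ω‖ = 1 := by
  have hx := h.norm_eq_one hω
  refine le_antisymm (ω.opNorm_le_bound zero_le_one fun a => ?_) ?_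
  · rw [one_mul]
    exact h.norm_apply_le hx a
  · have : Nontrivial A := ⟨1, 0, fun h0 => by
      have := hω.2
      rw [h0, map_zero] at this
      exact zero_ne_one this⟩
    have h1 := ω.le_opNorm 1
    rwa [hω.2, norm_one, CStarRing.norm_one, mul_one] at h1

/-- Vector states separated by a projection of the double commutant are orthogonal. -/
theorem statesOrthogonal_of_projection [PartialOrder A] [StarOrderedRing A] {π : HilbertRep A}
    {ω₀ ω₁ : StrongDual ℂ A} (h₀ : ω₀ ∈ stateSpace A) (h₁ : ω₁ ∈ stateSpace A) {x₀ x₁ : π.space}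
    (hx₀ : π.IsVectorFunctional x₀ ω₀) (hx₁ : π.IsVectorFunctional x₁ ω₁)
    {E : π.space →L[ℂ] π.space} (hE : E ∈ π.bicommutant) (hsa : IsSelfAdjoint E)
    (hE₀ : E x₀ = x₀) (hE₁ : E x₁ = 0) : StatesOrthogonal ω₀ ω₁ := by
  have n₀ := hx₀.norm_eq_one h₀
  have n₁ := hx₁.norm_eq_one h₁
  have N₀ := hx₀.norm_functional_eq_one h₀
  have N₁ := hx₁.norm_functional_eq_one h₁
  refine le_antisymm (norm_sub_le _ _) ?_
  rw [N₀, N₁]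
  refine le_of_forall_pos_le_add fun ε hε => ?_
  set T : π.space →L[ℂ] π.space := E + E - 1
  have hT : T ∈ π.bicommutant := sub_mem (add_mem hE hE) (one_mem _)
  have hcl := π.mem_closure_selfAdjoint hT ((hsa.add hsa).sub (IsSelfAdjoint.one _)) x₀ x₁
  have hT₀ : T x₀ = x₀ := by simp [T, hE₀]
  have hT₁ : T x₁ = -x₁ := by simp [T, hE₁]
  rw [hT₀, hT₁] at hcl
  obtain ⟨_, ⟨h, hh, rfl⟩, hd⟩ := Metric.mem_closure_iff.mp hcl (ε / 2) (half_pos hε)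
  rw [Prod.dist_eq, max_lt_iff, dist_comm, dist_comm (-x₁), dist_eq_norm, dist_eq_norm] at hd
  obtain ⟨k, hk, hk₀, hk₁⟩ := hh.exists_norm_le_one_star_mul_self_le
  have d₀ : ‖π.hom (k - 1) x₀‖ ≤ ε / 2 := by
    refine (π.norm_hom_apply_le_of_star_mul_self_le hk₀ x₀).trans (le_of_lt ?_)
    simpa using hd.1
  have d₁ : ‖π.hom (k + 1) x₁‖ ≤ ε / 2 := by
    refine (π.norm_hom_apply_le_of_star_mul_self_le hk₁ x₁).trans (le_of_lt ?_)
    simpa using hd.2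
  have f₀ : ‖ω₀ (k - 1)‖ ≤ ε / 2 := by
    rw [hx₀]
    exact (norm_inner_le_norm _ _).trans (by rwa [n₀, one_mul])
  have f₁ : ‖ω₁ (k + 1)‖ ≤ ε / 2 := by
    rw [hx₁]
    exact (norm_inner_le_norm _ _).trans (by rwa [n₁, one_mul])
  have hb : ‖(ω₀ - ω₁) k‖ ≤ ‖ω₀ - ω₁‖ :=
    ((ω₀ - ω₁).le_opNorm k).trans (mul_le_of_le_one_right (norm_nonneg _) hk)
  have e : (2 : ℂ) = (ω₀ - ω₁) k - ω₀ (k - 1) + ω₁ (k + 1) := by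
    rw [map_sub ω₀, map_add ω₁, h₀.2, h₁.2, sub_apply]
    ring
  have e2 : (2 : ℝ) ≤ ‖(ω₀ - ω₁) k‖ + ‖ω₀ (k - 1)‖ + ‖ω₁ (k + 1)‖ := by
    calc (2 : ℝ) = ‖(2 : ℂ)‖ := by simp
      _ ≤ _ := by
        rw [e]
        exact (norm_add_le _ _).trans (by gcongr; exact norm_sub_le _ _)
  linarith

/-- The real part of the inner product of unit vectors inducing orthogonal states vanishes. -/
theorem re_inner_eq_zero_of_statesOrthogonal {π : HilbertRep A} {ω₀ ω₁ : StrongDual ℂ A}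
    {x₀ x₁ : π.space} (hx₀ : π.IsVectorFunctional x₀ ω₀) (hx₁ : π.IsVectorFunctional x₁ ω₁)
    (n₀ : ‖x₀‖ = 1) (n₁ : ‖x₁‖ = 1) (h : ‖ω₀ - ω₁‖ = 2) : (⟪x₀, x₁⟫_ℂ).re = 0 := by
  set r := (⟪x₀, x₁⟫_ℂ).re with hr
  have hu : ‖x₀ + x₁‖ ^ 2 = 2 + 2 * r := by
    rw [norm_add_sq (𝕜 := ℂ), n₀, n₁]
    change 1 ^ 2 + 2 * r + 1 ^ 2 = _
    ring
  have hv : ‖x₀ - x₁‖ ^ 2 = 2 - 2 * r := by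
    rw [norm_sub_sq (𝕜 := ℂ), n₀, n₁]
    change 1 ^ 2 - 2 * r + 1 ^ 2 = _
    ring
  -- The difference of two quadratic forms is half the sum of the cross terms between `x₀ + x₁` and
  -- `x₀ - x₁`.
  have hb : ‖ω₀ - ω₁‖ ≤ ‖x₀ + x₁‖ * ‖x₀ - x₁‖ := by
    refine ContinuousLinearMap.opNorm_le_bound _ (by positivity) fun a => ?_
    have e : (ω₀ - ω₁) a =
        (⟪x₀ + x₁, π.hom a (x₀ - x₁)⟫_ℂ + ⟪x₀ - x₁, π.hom a (x₀ + x₁)⟫_ℂ) / 2 := by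
      rw [sub_apply, hx₀ a, hx₁ a]
      simp only [map_sub, map_add, inner_add_left, inner_sub_left, inner_add_right,
        inner_sub_right]
      ring
    have b : ∀ p q : π.space, ‖⟪p, π.hom a q⟫_ℂ‖ ≤ ‖p‖ * (‖a‖ * ‖q‖) := fun p q =>
      (norm_inner_le_norm _ _).trans (by
        gcongr
        exact (π.hom a).le_of_opNorm_le (π.norm_hom_le a) q)
    rw [e, norm_div, Complex.norm_two, div_le_iff₀ two_pos]
    refine (norm_add_le _ _).trans ((add_le_add (b _ _) (b _ _)).trans (le_of_eq ?_))
    ring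
  rw [h] at hb
  have h4 : (2 : ℝ) ^ 2 ≤ (2 + 2 * r) * (2 - 2 * r) := by
    rw [← hu, ← hv, ← mul_pow]
    exact pow_le_pow_left₀ zero_le_two hb 2
  nlinarith [sq_nonneg r]

theorem IsVectorFunctional.smul {π : HilbertRep A} {x : π.space} {ω : StrongDual ℂ A}
    (h : π.IsVectorFunctional x ω) {c : ℂ} (hc : ‖c‖ = 1) : π.IsVectorFunctional (c • x) ω := by
  intro a
  rw [map_smul, inner_smul_left, inner_smul_right, ← h a, ← mul_assoc, Complex.conj_mul', hc]
  simp

/-- Unit vectors inducing orthogonal states are orthogonal. -/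
theorem inner_eq_zero_of_statesOrthogonal {π : HilbertRep A} {ω₀ ω₁ : StrongDual ℂ A}
    {x₀ x₁ : π.space} (hx₀ : π.IsVectorFunctional x₀ ω₀) (hx₁ : π.IsVectorFunctional x₁ ω₁)
    (n₀ : ‖x₀‖ = 1) (n₁ : ‖x₁‖ = 1) (h : ‖ω₀ - ω₁‖ = 2) : ⟪x₀, x₁⟫_ℂ = 0 := by
  refine Complex.ext (re_inner_eq_zero_of_statesOrthogonal hx₀ hx₁ n₀ n₁ h) ?_
  have := re_inner_eq_zero_of_statesOrthogonal hx₀ (hx₁.smul Complex.norm_I) n₀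
    (by rw [norm_smul, Complex.norm_I, n₁, one_mul]) h
  rw [inner_smul_right] at this
  simpa using this

/-! ### Disjointness, summands and compressions -/

/-- Irreducible representations are disjoint if and only if they are inequivalent. -/
theorem IsIrreducible.isDisjoint_iff {π ρ : HilbertRep A} (hπ : π.IsIrreducible)
    (hρ : ρ.IsIrreducible) : π.IsDisjoint ρ ↔ ¬ π.UnitarilyEquivalent ρ := by
  have := hπ.nontrivial
  constructor
  · rintro h ⟨U, hU⟩
    refine top_ne_bot (h ⊤ ⊤ isClosed_univ isClosed_univ (fun _ _ _ => trivial)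
      (fun _ _ _ => trivial)
      ⟨((LinearIsometryEquiv.ofTop π.space ⊤ rfl).trans U).trans
        (LinearIsometryEquiv.ofTop ρ.space ⊤ rfl).symm, fun a x => Subtype.ext ?_⟩)
    exact hU a x
  · rintro h K L hKc hLc hK hL ⟨U, hU⟩
    by_contra hbot
    have hKtop := (hπ.eq_bot_or_eq_top K hKc hK).resolve_left hbot
    have hLtop : L = ⊤ := by
      refine (hρ.eq_bot_or_eq_top L hLc hL).resolve_left ?_
      rintro rfl
      refine hbot ((Submodule.eq_bot_iff _).mpr fun x hx => ?_)
      have h0 : U ⟨x, hx⟩ = 0 := Subsingleton.elim _ _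
      rw [map_eq_zero_iff U U.injective] at h0
      exact congrArg Subtype.val h0
    refine h ⟨((LinearIsometryEquiv.ofTop π.space K hKtop).symm.trans U).trans
      (LinearIsometryEquiv.ofTop ρ.space L hLtop), fun a x => ?_⟩
    subst hKtop
    exact congrArg Subtype.val (hU a ⟨x, trivial⟩)

theorem inner_projection_compression (π : HilbertRep A) {P : π.bicommutant}
    (hP : IsSelfAdjoint P) (x : π.space) (a : A) :
    π.bicommutantFunctional x (P * π.toBicommutant a * P) = ⟪P.1 x, π.hom a (P.1 x)⟫_ℂ := by
  have h : ContinuousLinearMap.adjoint P.1 = P.1 := congrArg Subtype.val hP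
  change ⟪x, P.1 (π.hom a (P.1 x))⟫_ℂ = _
  rw [← ContinuousLinearMap.adjoint_inner_left, h]

/-- At `a = 1` the compressed functional takes the value `‖P x‖²`. -/
theorem apply_eq_zero_of_compression_eq_zero (π : HilbertRep A) {P : π.bicommutant}
    (hP : IsSelfAdjoint P) (x : π.space)
    (h : ∀ a, π.bicommutantFunctional x (P * π.toBicommutant a * P) = 0) : P.1 x = 0 := by
  have h1 := h 1
  rw [inner_projection_compression π hP, map_one, one_apply_eq_self] at h1
  exact inner_self_eq_zero.mp h1

theorem GivenByOrthonormalVectors.of_isIrreducible {ω₀ ω₁ : StrongDual ℂ A} {π π₀ : HilbertRep A}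
    (h : π₀.GivenByOrthonormalVectors ω₀ ω₁) (hπ₀ : π₀.IsIrreducible) (hπ : π.IsReducedAtomic) :
    π.GivenByOrthonormalVectors ω₀ ω₁ := by
  obtain ⟨ι, σ, hσ, rfl⟩ := hπ
  obtain ⟨y₀, y₁, n₀, n₁, h01, hy₀, hy₁⟩ := h
  obtain ⟨i, hi⟩ := hσ.maximal π₀ hπ₀
  obtain ⟨U, hU⟩ := hi.symm
  have hvec : ∀ {y : π₀.space} {ω : StrongDual ℂ A}, π₀.IsVectorFunctional y ω →
      (σ i).IsVectorFunctional (U y) ω := fun hy a => by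
    rw [hy a, ← hU, U.inner_map_map]
  refine ⟨HilbertRep.incl σ i (U y₀), HilbertRep.incl σ i (U y₁), ?_, ?_, ?_, (hvec hy₀).incl,
    (hvec hy₁).incl⟩
  · rw [norm_incl, U.norm_map, n₀]
  · rw [norm_incl, U.norm_map, n₁]
  · rw [inner_incl_left, coord_incl_self, U.inner_map_map, h01]

section PureStates

variable [PartialOrder A] [StarOrderedRing A] {ω₀ ω₁ : StrongDual ℂ A}

/-- Each vector lies in the single summand equivalent to the GNS representation of its state. One
common summand serves as `π₀`; distinct summands are inequivalent, which for irreducibles means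
disjoint. -/
theorem GivenByOrthonormalVectors.disjoint_or_exists_irreducible (h₀ : ω₀ ∈ pureStates A)
    (h₁ : ω₁ ∈ pureStates A) {π : HilbertRep A} (hπ : π.IsReducedAtomic)
    (h : π.GivenByOrthonormalVectors ω₀ ω₁) :
    IsDisjoint (gns ω₀ h₀.1.1) (gns ω₁ h₁.1.1) ∨
      ∃ π₀ : HilbertRep A, π₀.IsIrreducible ∧ π₀.GivenByOrthonormalVectors ω₀ ω₁ := by
  obtain ⟨ι, σ, hσ, rfl⟩ := hπ
  obtain ⟨y₀, y₁, n₀, n₁, h01, hy₀, hy₁⟩ := h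
  obtain ⟨i, z₀, e₀, -, hz₀⟩ := hσ.exists_vector h₀
  obtain ⟨j, z₁, e₁, -, hz₁⟩ := hσ.exists_vector h₁
  obtain ⟨ν₀, hν₀⟩ := hz₀ y₀ 1 fun a => by rw [← hy₀ a]; simp
  obtain ⟨ν₁, hν₁⟩ := hz₁ y₁ 1 fun a => by rw [← hy₁ a]; simp
  rw [← map_smul] at hν₀ hν₁
  by_cases hij : i = j
  · subst hij
    subst hν₀ hν₁
    right
    refine ⟨σ i, hσ.irreducible i, ν₀ • z₀, ν₁ • z₁, ?_, ?_, ?_, fun a => ?_, fun a => ?_⟩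
    · rw [← norm_incl, n₀]
    · rw [← norm_incl, n₁]
    · rwa [inner_incl_left, coord_incl_self] at h01
    · rw [hy₀ a, hom_incl, inner_incl_left, coord_incl_self]
    · rw [hy₁ a, hom_incl, inner_incl_left, coord_incl_self]
  · left
    rw [(isIrreducible_gns h₀).isDisjoint_iff (isIrreducible_gns h₁)]
    exact fun he => hσ.inequivalent i j hij ((e₀.trans he).trans e₁.symm)

theorem givenByOrthonormalVectors_of_isDisjoint (h₀ : ω₀ ∈ pureStates A)
    (h₁ : ω₁ ∈ pureStates A) {π : HilbertRep A} (hπ : π.IsReducedAtomic)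
    (h : IsDisjoint (gns ω₀ h₀.1.1) (gns ω₁ h₁.1.1)) : π.GivenByOrthonormalVectors ω₀ ω₁ := by
  obtain ⟨ι, σ, hσ, rfl⟩ := hπ
  obtain ⟨i, z₀, e₀, hz₀, -⟩ := hσ.exists_vector h₀
  obtain ⟨j, z₁, e₁, hz₁, -⟩ := hσ.exists_vector h₁
  rw [(isIrreducible_gns h₀).isDisjoint_iff (isIrreducible_gns h₁)] at h
  have hij : i ≠ j := by
    rintro rfl
    exact h (e₀.symm.trans e₁)
  refine ⟨_, _, hz₀.incl.norm_eq_one h₀.1, hz₁.incl.norm_eq_one h₁.1, ?_, hz₀.incl, hz₁.incl⟩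
  rw [inner_incl_left, coord_incl_of_ne σ hij, inner_zero_right]

/-- A pure state is a vector state in a reduced atomic representation. -/
theorem IsReducedAtomic.exists_isVectorFunctional {π : HilbertRep A} (hπ : π.IsReducedAtomic)
    {ω : StrongDual ℂ A} (hω : ω ∈ pureStates A) :
    ∃ x : π.space, π.IsVectorFunctional x ω := by
  obtain ⟨ι, σ, hσ, rfl⟩ := hπ
  obtain ⟨i, z, -, hz, -⟩ := hσ.exists_vector hω
  exact ⟨_, hz.incl⟩

end PureStates

end HilbertRep

/-! ### The equivalences -/

theorem proposition2p4 {A : Type u} [CStarAlgebra A] [PartialOrder A] [StarOrderedRing A]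
    (ω₀ ω₁ : StrongDual ℂ A) (h₀ : ω₀ ∈ pureStates A) (h₁ : ω₁ ∈ pureStates A)
    (π : HilbertRep A) (hπ : π.IsReducedAtomic) :
    ∃ φ₀ φ₁ : π.bicommutant →ₗ[ℂ] ℂ,
      (IsNormalExtension π ω₀ φ₀ ∧ ∀ ψ, IsNormalExtension π ω₀ ψ → ψ = φ₀) ∧
      (IsNormalExtension π ω₁ φ₁ ∧ ∀ ψ, IsNormalExtension π ω₁ ψ → ψ = φ₁) ∧
      List.TFAE [
        StatesOrthogonal ω₀ ω₁,
        HilbertRep.IsDisjoint (HilbertRep.gns ω₀ h₀.1.1) (HilbertRep.gns ω₁ h₁.1.1) ∨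
          ∃ π₀ : HilbertRep A, π₀.IsIrreducible ∧ π₀.GivenByOrthonormalVectors ω₀ ω₁,
        π.GivenByOrthonormalVectors ω₀ ω₁,
        ∃ E : π.bicommutant, IsStarProjection E ∧
          (∀ a : A, φ₀ (E * π.toBicommutant a * E) = ω₀ a) ∧
          (∀ a : A, φ₀ ((1 - E) * π.toBicommutant a * (1 - E)) = 0) ∧
          (∀ a : A, φ₁ (E * π.toBicommutant a * E) = 0) ∧
          (∀ a : A, φ₁ ((1 - E) * π.toBicommutant a * (1 - E)) = ω₁ a)] := by
  obtain ⟨x₀, hx₀⟩ := hπ.exists_isVectorFunctional h₀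
  obtain ⟨x₁, hx₁⟩ := hπ.exists_isVectorFunctional h₁
  refine ⟨π.bicommutantFunctional x₀, π.bicommutantFunctional x₁,
    ⟨hx₀.isNormalExtension, fun ψ hψ => IsNormalExtension.unique hψ hx₀.isNormalExtension⟩,
    ⟨hx₁.isNormalExtension, fun ψ hψ => IsNormalExtension.unique hψ hx₁.isNormalExtension⟩, ?_⟩
  tfae_have 1 → 3 := by
    intro h
    have n₀ := hx₀.norm_eq_one h₀.1
    have n₁ := hx₁.norm_eq_one h₁.1
    refine ⟨x₀, x₁, n₀, n₁, ?_, hx₀, hx₁⟩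
    refine HilbertRep.inner_eq_zero_of_statesOrthogonal hx₀ hx₁ n₀ n₁ (h.trans ?_)
    rw [hx₀.norm_functional_eq_one h₀.1, hx₁.norm_functional_eq_one h₁.1]
    norm_num
  tfae_have 3 → 2 := fun h => h.disjoint_or_exists_irreducible h₀ h₁ hπ
  tfae_have 2 → 3 := by
    rintro (h | ⟨π₀, hπ₀, h⟩)
    · exact HilbertRep.givenByOrthonormalVectors_of_isDisjoint h₀ h₁ hπ h
    · exact h.of_isIrreducible hπ₀ hπ
  tfae_have 3 → 4 := by
    rintro ⟨y₀, y₁, n₀, n₁, h01, hy₀, hy₁⟩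
    -- The given orthonormal vectors may differ from `x₀`, `x₁`, but uniqueness of the normal
    -- extensions identifies the functionals.
    rw [IsNormalExtension.unique hx₀.isNormalExtension hy₀.isNormalExtension,
      IsNormalExtension.unique hx₁.isNormalExtension hy₁.isNormalExtension]
    have hproj : IsStarProjection (ℂ ∙ y₀).starProjection := isStarProjection_starProjection
    let E : π.bicommutant := ⟨(ℂ ∙ y₀).starProjection, hπ.starProjection_mem_bicommutant h₀ hy₀⟩
    have hE : IsStarProjection E :=
      ⟨Subtype.ext hproj.isIdempotentElem, Subtype.ext hproj.isSelfAdjoint⟩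
    have hE' := hE.one_sub.isSelfAdjoint
    have E₀ : E.1 y₀ = y₀ := by
      simp [E, Submodule.starProjection_unit_singleton ℂ n₀, n₀]
    have E₁ : E.1 y₁ = 0 := by
      simp [E, Submodule.starProjection_unit_singleton ℂ n₀, h01]
    have F₀ : (1 - E).1 y₀ = 0 := sub_eq_zero.mpr E₀.symm
    have F₁ : (1 - E).1 y₁ = y₁ := by
      change y₁ - E.1 y₁ = y₁
      rw [E₁, sub_zero]
    refine ⟨E, hE, fun a => ?_, fun a => ?_, fun a => ?_, fun a => ?_⟩
    · rw [π.inner_projection_compression hE.isSelfAdjoint, E₀, hy₀ a]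
    · rw [π.inner_projection_compression hE', F₀, inner_zero_left]
    · rw [π.inner_projection_compression hE.isSelfAdjoint, E₁, inner_zero_left]
    · rw [π.inner_projection_compression hE', F₁, hy₁ a]
  tfae_have 4 → 1 := by
    rintro ⟨E, hE, -, hE₀, hE₁, -⟩
    -- The two vanishing conditions say `(1 - E) x₀ = 0` and `E x₁ = 0`.
    have F₀ := π.apply_eq_zero_of_compression_eq_zero hE.one_sub.isSelfAdjoint x₀ hE₀
    have E₁ := π.apply_eq_zero_of_compression_eq_zero hE.isSelfAdjoint x₁ hE₁
    exact HilbertRep.statesOrthogonal_of_projection h₀.1 h₁.1 hx₀ hx₁ E.2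
      (congrArg Subtype.val hE.isSelfAdjoint) (sub_eq_zero.mp F₀).symm E₁
  tfae_finish
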